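/- Let $n\ge 0$ be an integer, let $A$ be a real symmetric $n\times n$ matrix, let $a,b_1\in\mathbb R^n$ and $c,d_1\in\mathbb R$, and put $f(x)=x^TAx+2a^Tx+c$ and $h_1(x)=2b_1^Tx+d_1$ for $x\in\mathbb R^n$. Let $S=\{(f(x),h_1(x)):x\in\mathbb R^n\}\subseteq\mathbb R^2$ and let $\mathbb R^2_+=\{(y_1,y_2)\in\mathbb R^2: y_1\ge 0,\ y_2\ge 0\}$. Suppose that $S$ is not convex. Then exactly one of the following two cases happens: (i) $S$ contains a continuous parametric curve $\{(u(t),v(t)):t\in\mathbb R\}$ with $\lim_{t\to\infty}u(t)=\lim_{t\to\infty}v(t)=-\infty$; (ii) $A=\alpha\, b_1b_1^T$ for some real $\alpha>0$. Moreover, in case (i) $S+\mathbb R^2_+=\mathbb R^2$, and in case (ii) $S+\mathbb R^2_+$ is convex. -/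

import Mathlib

open Filter Set
open scoped Matrix Pointwise

noncomputable section

/-- The quadratic function `f(x) = xᵀ A x + 2 aᵀ x + c` on `ℝⁿ`. -/
def quadFun {n : ℕ} (A : Matrix (Fin n) (Fin n) ℝ) (a : Fin n → ℝ) (c : ℝ)
    (x : Fin n → ℝ) : ℝ :=
  x ⬝ᵥ (A *ᵥ x) + 2 * (a ⬝ᵥ x) + c

/-- The affine function `h(x) = 2 bᵀ x + d` on `ℝⁿ`. -/
def affineFun {n : ℕ} (b : Fin n → ℝ) (d : ℝ) (x : Fin n → ℝ) : ℝ :=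
  2 * (b ⬝ᵥ x) + d

/-- The joint numerical range `{(f(x), h(x)) : x ∈ ℝⁿ} ⊆ ℝ²`. -/
def jointRange {n : ℕ} (f h : (Fin n → ℝ) → ℝ) : Set (ℝ × ℝ) :=
  Set.range fun x => (f x, h x)

/-- The nonnegative orthant `ℝ²₊` of the plane. -/
def nonnegOrthant : Set (ℝ × ℝ) := {p | 0 ≤ p.1 ∧ 0 ≤ p.2}

/-- `S` contains a (continuous) parametric curve `t ↦ (u(t), v(t))`, `t ∈ ℝ`, both of whose
coordinates tend to `-∞` as `t → ∞`. -/
def ContainsDescendingCurve (S : Set (ℝ × ℝ)) : Prop :=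
  ∃ u v : ℝ → ℝ, Continuous u ∧ Continuous v ∧ (∀ t : ℝ, (u t, v t) ∈ S) ∧
    Tendsto u atTop atBot ∧ Tendsto v atTop atBot

end

section QuadraticRange

variable {n : ℕ} {A : Matrix (Fin n) (Fin n) ℝ}

/-! Write `q x = x ⬝ᵥ (A *ᵥ x)`. Non-convexity forces `b₁ ≠ 0`. If `q` is negative somewhere, some
ray makes both `f` and `h₁` tend to `-∞` (`containsDescendingCurve_of_neg`). Otherwise `A` is
positive semidefinite and `q` must vanish on `b₁^⊥`: a direction there with `q > 0` would let `f`
grow at fixed `h₁`, making `S` convex (`convex_jointRange_of_pos_direction`). So `A` kills `b₁^⊥`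
and equals `α b₁ b₁ᵀ`, with `α ≠ 0` since two affine functions have a convex joint range. The cases
exclude each other: when `A = α b₁ b₁ᵀ` with `α > 0`, either `a` is a multiple of `b₁` and `f` is
bounded below, or `S` is the whole plane, which is convex. -/

lemma Matrix.IsSymm.dotProduct_mulVec_swap (hA : A.IsSymm) (x y : Fin n → ℝ) :
    x ⬝ᵥ (A *ᵥ y) = y ⬝ᵥ (A *ᵥ x) := by
  rw [Matrix.dotProduct_mulVec, ← Matrix.mulVec_transpose, hA.eq, dotProduct_comm]

lemma Matrix.IsSymm.quadForm_combo (hA : A.IsSymm) (x y : Fin n → ℝ) (s t : ℝ) :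
    (s • x + t • y) ⬝ᵥ (A *ᵥ (s • x + t • y)) =
      s ^ 2 * (x ⬝ᵥ (A *ᵥ x)) + 2 * s * t * (x ⬝ᵥ (A *ᵥ y)) + t ^ 2 * (y ⬝ᵥ (A *ᵥ y)) := by
  simp only [Matrix.mulVec_add, Matrix.mulVec_smul, dotProduct_add, add_dotProduct,
    smul_dotProduct, dotProduct_smul, smul_eq_mul]
  rw [hA.dotProduct_mulVec_swap y x]
  ring

lemma quadFun_combo (hA : A.IsSymm) (a : Fin n → ℝ) (c : ℝ) (x y : Fin n → ℝ) (s t : ℝ) :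
    quadFun A a c (s • x + t • y) =
      s ^ 2 * (x ⬝ᵥ (A *ᵥ x)) + 2 * s * t * (x ⬝ᵥ (A *ᵥ y)) + t ^ 2 * (y ⬝ᵥ (A *ᵥ y))
        + 2 * (s * (a ⬝ᵥ x) + t * (a ⬝ᵥ y)) + c := by
  simp only [quadFun, hA.quadForm_combo, dotProduct_add, dotProduct_smul, smul_eq_mul]

lemma affineFun_combo (b : Fin n → ℝ) (d : ℝ) (x y : Fin n → ℝ) (s t : ℝ) :
    affineFun b d (s • x + t • y) = 2 * (s * (b ⬝ᵥ x) + t * (b ⬝ᵥ y)) + d := by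
  simp only [affineFun, dotProduct_add, dotProduct_smul, smul_eq_mul]

lemma continuous_quadFun (A : Matrix (Fin n) (Fin n) ℝ) (a : Fin n → ℝ) (c : ℝ) :
    Continuous (quadFun A a c) := by
  unfold quadFun dotProduct Matrix.mulVec dotProduct
  fun_prop

lemma quadFun_convex_combo_le (hA : A.IsSymm) (hpos : ∀ x : Fin n → ℝ, 0 ≤ x ⬝ᵥ (A *ᵥ x))
    (a : Fin n → ℝ) (c : ℝ) (x y : Fin n → ℝ) {s t : ℝ} (hs : 0 ≤ s) (ht : 0 ≤ t)
    (hst : s + t = 1) :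
    quadFun A a c (s • x + t • y) ≤ s * quadFun A a c x + t * quadFun A a c y := by
  -- The convexity gap is exactly `s * t * q (x - y)`.
  have h := hA.quadForm_combo x y 1 (-1)
  have h1 := hpos ((1 : ℝ) • x + (-1 : ℝ) • y)
  have h2 := mul_nonneg (mul_nonneg hs ht) h1
  rw [h] at h2
  rw [quadFun_combo hA]
  unfold quadFun
  obtain rfl : t = 1 - s := by linarith
  linarith

lemma affineFun_convex_combo (b : Fin n → ℝ) (d : ℝ) (x y : Fin n → ℝ) {s t : ℝ}
    (hst : s + t = 1) :
    affineFun b d (s • x + t • y) = s * affineFun b d x + t * affineFun b d y := by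
  rw [affineFun_combo]
  unfold affineFun
  obtain rfl : t = 1 - s := by linarith
  ring

lemma convex_jointRange_add_nonnegOrthant (hA : A.IsSymm)
    (hpos : ∀ x : Fin n → ℝ, 0 ≤ x ⬝ᵥ (A *ᵥ x)) (a : Fin n → ℝ) (c : ℝ) (b : Fin n → ℝ) (d : ℝ) :
    Convex ℝ (jointRange (quadFun A a c) (affineFun b d) + nonnegOrthant) := by
  rintro _ ⟨_, ⟨x, rfl⟩, ⟨p₁, p₂⟩, ⟨hp₁, hp₂⟩, rfl⟩ _ ⟨_, ⟨y, rfl⟩, ⟨q₁, q₂⟩, ⟨hq₁, hq₂⟩, rfl⟩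
    s t hs ht hst
  dsimp only at hp₁ hp₂ hq₁ hq₂
  have hle := quadFun_convex_combo_le hA hpos a c x y hs ht hst
  have h1 := mul_nonneg hs hp₁
  have h2 := mul_nonneg ht hq₁
  have h3 := mul_nonneg hs hp₂
  have h4 := mul_nonneg ht hq₂
  -- The convexity gap of `f` is absorbed by the first orthant coordinate.
  refine ⟨_, ⟨s • x + t • y, rfl⟩,
    (s * (quadFun A a c x + p₁) + t * (quadFun A a c y + q₁) - quadFun A a c (s • x + t • y),
      s * p₂ + t * q₂), ⟨?_, ?_⟩, ?_⟩
  · dsimp only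
    linarith
  · dsimp only
    linarith
  · simp only [affineFun_convex_combo b d x y hst, Prod.mk_add_mk, Prod.smul_mk, smul_eq_mul,
      Prod.mk.injEq]
    constructor <;> ring

lemma ContainsDescendingCurve.add_nonnegOrthant_eq_univ {S : Set (ℝ × ℝ)}
    (hS : ContainsDescendingCurve S) : S + nonnegOrthant = Set.univ := by
  obtain ⟨u, v, -, -, hmem, hu, hv⟩ := hS
  refine eq_univ_of_forall fun ⟨y₁, y₂⟩ => ?_
  obtain ⟨t, h₁, h₂⟩ :=
    ((hu.eventually (eventually_le_atBot y₁)).and (hv.eventually (eventually_le_atBot y₂))).exists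
  exact ⟨_, hmem t, (y₁ - u t, y₂ - v t), ⟨sub_nonneg.2 h₁, sub_nonneg.2 h₂⟩, by simp⟩

/-- If the linear part of `h` vanishes, the joint range is a segment of a horizontal line. -/
lemma convex_jointRange_of_linear_eq_zero (A : Matrix (Fin n) (Fin n) ℝ) (a : Fin n → ℝ) (c : ℝ)
    (d : ℝ) : Convex ℝ (jointRange (quadFun A a c) (affineFun 0 d)) := by
  have h : Convex ℝ (range (quadFun A a c)) :=
    (isPreconnected_range (continuous_quadFun A a c)).ordConnected.convex
  have heq : jointRange (quadFun A a c) (affineFun 0 d) = range (quadFun A a c) ×ˢ {d} := by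
    ext ⟨p, q⟩
    simp [jointRange, affineFun, eq_comm]
  rw [heq]
  exact h.prod (convex_singleton d)

/-- `q` is even, so the sign of `x` is free; if `b ⬝ᵥ x = 0`, a small negative multiple of `b` added
to `x` keeps `q` negative by continuity. -/
lemma exists_neg_direction {b : Fin n → ℝ} (hA : A.IsSymm) (hb : b ≠ 0)
    {x : Fin n → ℝ} (hx : x ⬝ᵥ (A *ᵥ x) < 0) :
    ∃ y : Fin n → ℝ, y ⬝ᵥ (A *ᵥ y) < 0 ∧ b ⬝ᵥ y < 0 := by
  have hbb : 0 < b ⬝ᵥ b :=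
    lt_of_le_of_ne (Finset.sum_nonneg fun i _ => mul_self_nonneg (b i))
      (Ne.symm (mt dotProduct_self_eq_zero.1 hb))
  rcases lt_trichotomy (b ⬝ᵥ x) 0 with h | h | h
  · exact ⟨x, hx, h⟩
  · have hlim : Tendsto (fun t : ℝ => (1 : ℝ) ^ 2 * (x ⬝ᵥ (A *ᵥ x)) +
        2 * 1 * t * (x ⬝ᵥ (A *ᵥ b)) + t ^ 2 * (b ⬝ᵥ (A *ᵥ b))) (nhdsWithin 0 (Iio 0))
        (nhds (x ⬝ᵥ (A *ᵥ x))) := by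
      refine tendsto_nhdsWithin_of_tendsto_nhds ?_
      refine Continuous.tendsto' (by fun_prop) _ _ (by simp)
    obtain ⟨t, h₁, h₂⟩ := ((hlim.eventually_lt_const hx).and self_mem_nhdsWithin).exists
    refine ⟨(1 : ℝ) • x + t • b, by rwa [hA.quadForm_combo], ?_⟩
    simp only [dotProduct_add, dotProduct_smul, smul_eq_mul, h]
    have := mul_neg_of_neg_of_pos (show t < 0 from h₂) hbb
    linarith
  · exact ⟨-x, by simpa [Matrix.mulVec_neg] using hx, by simpa using h⟩

lemma tendsto_quadratic_atBot {p : ℝ} (hp : p < 0) (q r : ℝ) :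
    Tendsto (fun t : ℝ => p * t ^ 2 + q * t + r) atTop atBot := by
  have h : Tendsto (fun t : ℝ => p * t + q) atTop atBot :=
    tendsto_atBot_add_const_right _ _ (tendsto_id.const_mul_atTop_of_neg hp)
  refine (tendsto_atBot_add_const_right _ r (h.atBot_mul_atTop₀ tendsto_id)).congr fun t => ?_
  simp only [id]
  ring

/-- An indefinite or negative direction of `A` yields a descending ray. -/
lemma containsDescendingCurve_of_neg {b : Fin n → ℝ} (hA : A.IsSymm) (a : Fin n → ℝ) (c d : ℝ)
    (hb : b ≠ 0) {x : Fin n → ℝ} (hx : x ⬝ᵥ (A *ᵥ x) < 0) :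
    ContainsDescendingCurve (jointRange (quadFun A a c) (affineFun b d)) := by
  obtain ⟨y, hy, hby⟩ := exists_neg_direction hA hb hx
  refine ⟨fun t => quadFun A a c (t • y), fun t => affineFun b d (t • y),
    (continuous_quadFun A a c).comp (by fun_prop), ?_, fun t => ⟨t • y, rfl⟩, ?_, ?_⟩
  · simp only [affineFun, dotProduct_smul]
    fun_prop
  · refine (tendsto_quadratic_atBot hy (2 * (a ⬝ᵥ y)) c).congr fun t => ?_
    simp only [quadFun, Matrix.mulVec_smul, dotProduct_smul, smul_dotProduct, smul_eq_mul]
    ring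
  · refine (tendsto_atBot_add_const_right _ d
      (tendsto_id.const_mul_atTop_of_neg (show 2 * (b ⬝ᵥ y) < 0 by linarith))).congr fun t => ?_
    simp only [affineFun, dotProduct_smul, smul_eq_mul, id]
    ring

/-- If `f` is convex and strictly convex along a direction on which `h` is constant, then the
joint range is the image of an epigraph, hence convex. -/
lemma convex_jointRange_of_pos_direction {b : Fin n → ℝ} (hA : A.IsSymm)
    (hpos : ∀ x : Fin n → ℝ, 0 ≤ x ⬝ᵥ (A *ᵥ x)) (a : Fin n → ℝ) (c d : ℝ)
    {w : Fin n → ℝ} (hw : 0 < w ⬝ᵥ (A *ᵥ w)) (hbw : b ⬝ᵥ w = 0) :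
    Convex ℝ (jointRange (quadFun A a c) (affineFun b d)) := by
  rintro _ ⟨x, rfl⟩ _ ⟨y, rfl⟩ s t hs ht hst
  set z := s • x + t • y with hz
  set g : ℝ → ℝ := fun r => quadFun A a c ((1 : ℝ) • z + r • w)
  have hg : Continuous g := (continuous_quadFun A a c).comp (by fun_prop)
  have hlim : Tendsto g atTop atTop := by
    rw [← tendsto_neg_atBot_iff]
    refine (tendsto_quadratic_atBot (neg_neg_of_pos hw)
      (-(2 * (z ⬝ᵥ (A *ᵥ w)) + 2 * (a ⬝ᵥ w))) (-quadFun A a c z)).congr fun r => ?_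
    simp only [g, quadFun_combo hA]
    unfold quadFun
    ring
  have h0 : g 0 ≤ s * quadFun A a c x + t * quadFun A a c y := by
    simpa [g] using quadFun_convex_combo_le hA hpos a c x y hs ht hst
  obtain ⟨R, hR₀, hR⟩ := ((eventually_ge_atTop (0 : ℝ)).and
    (hlim.eventually_ge_atTop (s * quadFun A a c x + t * quadFun A a c y))).exists
  obtain ⟨r, -, hr⟩ := intermediate_value_Icc hR₀ hg.continuousOn ⟨h0, hR⟩
  refine ⟨(1 : ℝ) • z + r • w, ?_⟩
  simp only [Prod.smul_mk, Prod.mk_add_mk, smul_eq_mul, Prod.mk.injEq]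
  refine ⟨hr, ?_⟩
  rw [← affineFun_convex_combo b d x y hst, affineFun_combo, hbw]
  simp [affineFun, hz]

lemma dotProduct_sub_proj {b : Fin n → ℝ} (hb : b ≠ 0) (x : Fin n → ℝ) :
    b ⬝ᵥ (x - ((b ⬝ᵥ x) / (b ⬝ᵥ b)) • b) = 0 := by
  have hbb : b ⬝ᵥ b ≠ 0 := mt dotProduct_self_eq_zero.1 hb
  simp only [dotProduct_sub, dotProduct_smul, smul_eq_mul]
  field_simp
  ring

/-- A symmetric matrix vanishing on `b^⊥` is a multiple of `b bᵀ`. -/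
lemma eq_smul_vecMulVec_of_mulVec_eq_zero {b : Fin n → ℝ} (hA : A.IsSymm) (hb : b ≠ 0)
    (h : ∀ w : Fin n → ℝ, b ⬝ᵥ w = 0 → A *ᵥ w = 0) :
    A = ((b ⬝ᵥ (A *ᵥ b)) / (b ⬝ᵥ b) ^ 2) • Matrix.vecMulVec b b := by
  have hmul (x : Fin n → ℝ) : A *ᵥ x = ((b ⬝ᵥ x) / (b ⬝ᵥ b)) • (A *ᵥ b) := by
    have := h _ (dotProduct_sub_proj hb x)
    rwa [Matrix.mulVec_sub, Matrix.mulVec_smul, sub_eq_zero] at this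
  have hform (x y : Fin n → ℝ) : x ⬝ᵥ (A *ᵥ y) =
      (b ⬝ᵥ (A *ᵥ b)) / (b ⬝ᵥ b) ^ 2 * ((b ⬝ᵥ x) * (b ⬝ᵥ y)) := by
    rw [hmul y, dotProduct_smul, hA.dotProduct_mulVec_swap x b, hmul x, dotProduct_smul,
      smul_eq_mul, smul_eq_mul]
    have hbb : b ⬝ᵥ b ≠ 0 := mt dotProduct_self_eq_zero.1 hb
    field_simp
  ext i j
  -- The bilinear form on basis vectors gives the matrix entries.
  have := hform (Pi.single i 1) (Pi.single j 1)
  simpa [Matrix.vecMulVec_apply] using this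

lemma convex_jointRange_of_zero (a : Fin n → ℝ) (c : ℝ) (b : Fin n → ℝ) (d : ℝ) :
    Convex ℝ (jointRange (quadFun 0 a c) (affineFun b d)) := by
  rintro _ ⟨x, rfl⟩ _ ⟨y, rfl⟩ s t hs ht hst
  refine ⟨s • x + t • y, ?_⟩
  have h (z : Fin n → ℝ) : quadFun 0 a c z = affineFun a c z := by
    simp [quadFun, affineFun]
  simp only [h, affineFun_convex_combo _ _ x y hst, Prod.smul_mk, Prod.mk_add_mk, smul_eq_mul]

lemma dotProduct_smul_vecMulVec_mulVec (α : ℝ) (b x y : Fin n → ℝ) :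
    x ⬝ᵥ ((α • Matrix.vecMulVec b b) *ᵥ y) = α * ((b ⬝ᵥ x) * (b ⬝ᵥ y)) := by
  rw [Matrix.smul_mulVec, Matrix.vecMulVec_mulVec, dotProduct_smul, op_smul_eq_smul,
    dotProduct_smul, smul_eq_mul, smul_eq_mul, dotProduct_comm x b]
  ring

/-- For `A = α b bᵀ` and `a` not a multiple of `b`, the joint range is the whole plane. -/
lemma jointRange_smul_vecMulVec_eq_univ (α : ℝ) {a b w : Fin n → ℝ} (c d : ℝ) (hb : b ≠ 0)
    (hbw : b ⬝ᵥ w = 0) (haw : a ⬝ᵥ w ≠ 0) :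
    jointRange (quadFun (α • Matrix.vecMulVec b b) a c) (affineFun b d) = univ := by
  have hbb : b ⬝ᵥ b ≠ 0 := mt dotProduct_self_eq_zero.1 hb
  refine eq_univ_of_forall fun ⟨y₁, y₂⟩ => ?_
  -- `s` fixes the value of `h`; along `w` the quadratic part is constant, so `f` is affine with
  -- nonzero slope and reaches `y₁`.
  set s := (y₂ - d) / (2 * (b ⬝ᵥ b)) with hs
  refine ⟨s • b + ((y₁ - quadFun (α • Matrix.vecMulVec b b) a c (s • b)) / (2 * (a ⬝ᵥ w))) • w, ?_⟩
  simp only [Prod.mk.injEq]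
  constructor
  · simp only [quadFun, dotProduct_smul_vecMulVec_mulVec, dotProduct_add, dotProduct_smul,
      smul_eq_mul, hbw]
    field_simp
    ring
  · rw [affineFun_combo, hbw, hs]
    field_simp
    ring

/-- Here `a = β b`, and completing the square bounds `f` below by `c - β ^ 2 / α`. -/
lemma not_containsDescendingCurve_of_smul_vecMulVec {α : ℝ} (hα : 0 < α) {a b : Fin n → ℝ}
    (c d : ℝ) (hb : b ≠ 0) (hab : ∀ w : Fin n → ℝ, b ⬝ᵥ w = 0 → a ⬝ᵥ w = 0) :
    ¬ ContainsDescendingCurve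
      (jointRange (quadFun (α • Matrix.vecMulVec b b) a c) (affineFun b d)) := by
  rintro ⟨u, v, -, -, hmem, hu, -⟩
  set β := (a ⬝ᵥ b) / (b ⬝ᵥ b) with hβ
  obtain ⟨t, ht⟩ := (hu.eventually (eventually_lt_atBot (c - β ^ 2 / α))).exists
  obtain ⟨x, hx⟩ := hmem t
  have hax : a ⬝ᵥ x = β * (b ⬝ᵥ x) := by
    have := hab _ (dotProduct_sub_proj hb x)
    simp only [dotProduct_sub, dotProduct_smul, smul_eq_mul] at this
    rw [hβ, sub_eq_zero.1 this]
    ring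
  have hux : quadFun (α • Matrix.vecMulVec b b) a c x = u t := congrArg Prod.fst hx
  rw [← hux, quadFun, dotProduct_smul_vecMulVec_mulVec, hax] at ht
  have hsq : 0 ≤ α * (b ⬝ᵥ x + β / α) ^ 2 := by positivity
  have hexp : α * (b ⬝ᵥ x + β / α) ^ 2 =
      α * ((b ⬝ᵥ x) * (b ⬝ᵥ x)) + 2 * (β * (b ⬝ᵥ x)) + β ^ 2 / α := by
    field_simp
    ring
  linarith

end QuadraticRange

theorem mainTheorem8 (n : ℕ) (A : Matrix (Fin n) (Fin n) ℝ) (hA : A.IsSymm)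
    (a : Fin n → ℝ) (c : ℝ) (b₁ : Fin n → ℝ) (d₁ : ℝ) (S : Set (ℝ × ℝ))
    (hS : S = jointRange (quadFun A a c) (affineFun b₁ d₁))
    (hnc : ¬ Convex ℝ S) :
    Xor (ContainsDescendingCurve S)
        (∃ α : ℝ, 0 < α ∧ A = α • Matrix.vecMulVec b₁ b₁) ∧
      (ContainsDescendingCurve S → S + nonnegOrthant = Set.univ) ∧
      ((∃ α : ℝ, 0 < α ∧ A = α • Matrix.vecMulVec b₁ b₁) →
        Convex ℝ (S + nonnegOrthant)) := by
  subst hS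
  have hb : b₁ ≠ 0 := by
    rintro rfl
    exact hnc (convex_jointRange_of_linear_eq_zero A a c d₁)
  refine ⟨xor_iff_or_and_not_and _ _ |>.2 ⟨?_, ?_⟩, fun h => h.add_nonnegOrthant_eq_univ, ?_⟩
  · by_cases hpos : ∀ x : Fin n → ℝ, 0 ≤ x ⬝ᵥ (A *ᵥ x)
    · right
      have hzero (w : Fin n → ℝ) (hbw : b₁ ⬝ᵥ w = 0) : A *ᵥ w = 0 := by
        have hpsd : A.PosSemidef := Matrix.PosSemidef.of_dotProduct_mulVec_nonneg
          (by rw [Matrix.IsHermitian, Matrix.conjTranspose_eq_transpose_of_trivial, hA.eq])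
          (by simpa using hpos)
        by_contra hw
        refine hnc (convex_jointRange_of_pos_direction hA hpos a c d₁
          (lt_of_le_of_ne (hpos w) fun h => hw ?_) hbw)
        -- Semidefiniteness upgrades `q w = 0` to `A *ᵥ w = 0`.
        exact (hpsd.dotProduct_mulVec_zero_iff w).1 (by simpa using h.symm)
      have hform := eq_smul_vecMulVec_of_mulVec_eq_zero hA hb hzero
      refine ⟨_, lt_of_le_of_ne (div_nonneg (hpos b₁) (sq_nonneg _)) fun h => hnc ?_, hform⟩
      rw [← h, zero_smul] at hform
      rw [hform]
      exact convex_jointRange_of_zero a c b₁ d₁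
    · push Not at hpos
      obtain ⟨x, hx⟩ := hpos
      exact Or.inl (containsDescendingCurve_of_neg hA a c d₁ hb hx)
  · rintro ⟨hcurve, α, hα, rfl⟩
    refine not_containsDescendingCurve_of_smul_vecMulVec hα c d₁ hb (fun w hbw => ?_) hcurve
    by_contra haw
    rw [jointRange_smul_vecMulVec_eq_univ α c d₁ hb hbw haw] at hnc
    exact hnc convex_univ
  · rintro ⟨α, hα, rfl⟩
    refine convex_jointRange_add_nonnegOrthant hA (fun x => ?_) a c b₁ d₁
    rw [dotProduct_smul_vecMulVec_mulVec]
    exact mul_nonneg hα.le (mul_self_nonneg _)
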